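/- Consider $n$ agents with translations $T_i(t)\in\mathbb{R}^3$ and rotations $R_i(t)\in SO(3)$, where $\dot T_i = R_i v_i$ and $v_i$ is the control. Let $a_{ij}>0$ ($i,j=1,\dots,n$) be fixed weights. Each agent $i$ has a time-varying neighborhood $\mathcal{N}_i(t)\subseteq\{1,\dots,n\}$, $t\in\mathbb{R}$, with $i\in\mathcal{N}_i(t)$, which is piecewise constant and right-continuous in $t$, and there is $\tau_D>0$ such that any two consecutive switching times of $\mathcal{N}_i$ are more than $\tau_D$ apart, for every $i$ (switching times of different agents may be arbitrarily close). Let $\mathcal{G}(t)$ be the digraph on $\{1,\dots,n\}$ in which $(i,j)$ is an edge if and only if $j\in\mathcal{N}_i(t)$. Suppose that $\mathcal{G}$ is uniformly quasi-strongly connected: there is $S>0$ such that for every $t\in\mathbb{R}$ the union graph $\bigcup_{s\in[t,t+S)}\mathcal{G}(s)$ has a node to which there is a directed path from every other node. Let the controller be $$v_i=\sum_{j\in\mathcal{N}_i(t)}a_{ij}T_{ij},\qquad T_{ij}=R_i^{T}(T_j-T_i).$$ Then, whatever the rotation trajectories $R_i(\cdot)$ are, the closed loop for $T=[T_1^T,\dots,T_n^T]^T\in\mathbb{R}^{3n}$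 is the linear switched system $$\dot T=-(L(t)\otimes I_3)\,T,$$ where $L(t)=D(t)-A(t)$, $A(t)$ has entries $a_{ij}$ if $j\in\mathcal{N}_i(t)$ and $0$ otherwise, and $D(t)$ is the diagonal matrix of the row sums of $A(t)$. Moreover, the consensus set $\mathcal{A}=\{T\in\mathbb{R}^{3n}: T_i=T_j\ \text{for all } i,j\}$ is globally asymptotically stable for this system. That is, with $\|z\|_{\mathcal{A}}=\inf_{w\in\mathcal{A}}\|z-w\|$: for every initial time $t_0\in\mathbb{R}$ and every initial state there is a unique solution on $[t_0,\infty)$; for every $t_0$ and every $\varepsilon>0$ there is $\delta>0$ such that every solution with $\|T(t_0)\|_{\mathcal{A}}\le\delta$ satisfies $\|T(t)\|_{\mathcal{A}}\le\varepsilon$ for all $t\ge t_0$; and every solution satisfies $\|T(t)\|_{\mathcal{A}}\to 0$ as $t\to\infty$. (Solutions are continuous functions of time that satisfy the differential equation with the right derivative at every $t\ge t_0$.) -/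

import Mathlib

open Set Filter Topology
open scoped Kronecker Matrix

namespace TranslationConsensus

/-! ### Time-varying systems and asymptotic stability of sets -/

section Stability

variable {E : Type*} [NormedAddCommGroup E] [NormedSpace ℝ E]

/-- `z` is a (forward complete) solution of `ż = f(t, z)` on `[t₀, ∞)`: it is continuous and its
right derivative at every `t ≥ t₀` is `f t (z t)`. For `f` that is right-continuous and
piecewise constant in `t` this is the usual notion: `z` is continuous, and differentiable with
`ż = f(t, z)` between the switching times. -/
structure IsSolution (f : ℝ → E → E) (t₀ : ℝ) (z : ℝ → E) : Prop where
  continuousOn : ContinuousOn z (Ici t₀)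
  hasDerivWithinAt : ∀ t, t₀ ≤ t → HasDerivWithinAt z (f t (z t)) (Ici t) t

/-- For all initial data `(t₀, z₀)` the solution exists on all of `[t₀, ∞)` and is unique. -/
def HasUniqueSolutions (f : ℝ → E → E) : Prop :=
  ∀ (t₀ : ℝ) (z₀ : E), ∃ z : ℝ → E, IsSolution f t₀ z ∧ z t₀ = z₀ ∧
    ∀ w : ℝ → E, IsSolution f t₀ w → w t₀ = z₀ → EqOn w z (Ici t₀)

/-- The set `D` is stable: solutions starting close to `D` stay close to `D`. -/
def IsStableSet (f : ℝ → E → E) (D : Set E) : Prop :=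
  ∀ t₀ : ℝ, ∀ ε > 0, ∃ δ > 0, ∀ z : ℝ → E, IsSolution f t₀ z →
    Metric.infDist (z t₀) D ≤ δ → ∀ t, t₀ ≤ t → Metric.infDist (z t) D ≤ ε

/-- The set `D` is globally attractive: every solution approaches `D`. -/
def IsGloballyAttractiveSet (f : ℝ → E → E) (D : Set E) : Prop :=
  ∀ (t₀ : ℝ) (z : ℝ → E), IsSolution f t₀ z →
    Tendsto (fun t => Metric.infDist (z t) D) atTop (𝓝 0)

/-- The set `D` is globally asymptotically stable for `ż = f(t, z)`: the system has unique forward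
complete solutions for all initial data, and `D` is stable and globally attractive. -/
structure IsGloballyAsymptoticallyStable (f : ℝ → E → E) (D : Set E) : Prop where
  hasUniqueSolutions : HasUniqueSolutions f
  stable : IsStableSet f D
  attractive : IsGloballyAttractiveSet f D

end Stability

/-! ### Switching signals and graphs -/

/-- `t` is a switching time (a discontinuity) of a signal `s` with values in a discrete set. -/
def IsSwitchTime {α : Type*} (s : ℝ → α) (t : ℝ) : Prop :=
  ¬ ∀ᶠ u in 𝓝 t, s u = s t

/-- `s` is a right-continuous switching signal for which any two switching times are more than `τ`
apart. For `τ > 0` such a signal is piecewise constant: it is locally constant, hence constant,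
between two consecutive switching times. -/
structure IsSwitchingSignal {α : Type*} (s : ℝ → α) (τ : ℝ) : Prop where
  rightContinuous : ∀ t, ∀ᶠ u in 𝓝[≥] t, s u = s t
  dwell : ∀ t₁ t₂, IsSwitchTime s t₁ → IsSwitchTime s t₂ → t₁ < t₂ → τ < t₂ - t₁

/-- The possible neighbourhoods of agent `i`: the sets of agents that contain `i`. -/
abbrev Neighborhood {n : ℕ} (i : Fin n) : Type := {N : Finset (Fin n) // i ∈ N}

/-- The digraph with an edge `(i, j)` if and only if `j` is a neighbour of `i`. -/
def neighborGraph {n : ℕ} (N : ∀ i : Fin n, Neighborhood i) : Digraph (Fin n) where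
  Adj i j := j ∈ (N i).1

/-- The union over `t ∈ [t₁, t₂)` of the neighbourhood graphs given by the signals `σ`. -/
def unionGraph {n : ℕ} (σ : ∀ i : Fin n, ℝ → Neighborhood i) (t₁ t₂ : ℝ) : Digraph (Fin n) where
  Adj i j := ∃ t ∈ Ico t₁ t₂, (neighborGraph fun k => σ k t).Adj i j

/-- There is a center: a node to which there is a directed path from every node. -/
def IsQuasiStronglyConnected {n : ℕ} (G : Digraph (Fin n)) : Prop :=
  ∃ c, ∀ i, Relation.ReflTransGen G.Adj i c

/-- For some `S > 0`, the union graph over `[t, t + S)` is quasi-strongly connected for all `t`. -/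
def IsUniformlyQuasiStronglyConnected {n : ℕ} (σ : ∀ i : Fin n, ℝ → Neighborhood i) : Prop :=
  ∃ S > 0, ∀ t : ℝ, IsQuasiStronglyConnected (unionGraph σ t (t + S))

/-- The adjacency matrix of the neighbourhood graph: `a i j` on edges and `0` elsewhere. -/
def adjacency {n : ℕ} (a : Matrix (Fin n) (Fin n) ℝ) (N : ∀ i : Fin n, Neighborhood i) :
    Matrix (Fin n) (Fin n) ℝ :=
  Matrix.of fun i j => if j ∈ (N i).1 then a i j else 0

/-- The graph Laplacian `D - A`, where `D` is the diagonal matrix of the row sums of `A`. -/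
def laplacian {n : ℕ} (A : Matrix (Fin n) (Fin n) ℝ) : Matrix (Fin n) (Fin n) ℝ :=
  Matrix.diagonal (fun i => ∑ j, A i j) - A

/-! ### Translations and their control -/

/-- `ℝ³ⁿ` with the Euclidean norm; coordinate `(i, k)` is the `k`-th coordinate of agent `i`. -/
abbrev TotalTranslation (n : ℕ) : Type := EuclideanSpace ℝ (Fin n × Fin 3)

/-- The translation `T_i ∈ ℝ³` of agent `i`. -/
def translation {n : ℕ} (T : TotalTranslation n) (i : Fin n) : Fin 3 → ℝ :=
  fun k => T (i, k)

/-- The relative translation `T_ij = R_iᵀ (T_j - T_i)`. -/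
def relTranslation {n : ℕ} (R : Fin n → Matrix.specialOrthogonalGroup (Fin 3) ℝ)
    (T : TotalTranslation n) (i j : Fin n) : Fin 3 → ℝ :=
  (R i : Matrix (Fin 3) (Fin 3) ℝ)ᵀ *ᵥ (translation T j - translation T i)

/-- The controller `v_i = ∑_{j ∈ N_i} a_ij T_ij`. -/
def linearVelocity {n : ℕ} (a : Matrix (Fin n) (Fin n) ℝ) (N : ∀ i : Fin n, Neighborhood i)
    (R : Fin n → Matrix.specialOrthogonalGroup (Fin 3) ℝ) (T : TotalTranslation n) (i : Fin n) :
    Fin 3 → ℝ :=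
  ∑ j ∈ (N i).1, a i j • relTranslation R T i j

/-- The right-hand side, at time `t` and state `T`, of the kinematics `Ṫ_i = R_i(t) v_i`
(`i = 1, …, n`) in closed loop with the controller, along the rotation trajectories `R`. -/
noncomputable def closedLoop {n : ℕ} (a : Matrix (Fin n) (Fin n) ℝ)
    (σ : ∀ i : Fin n, ℝ → Neighborhood i)
    (R : ℝ → Fin n → Matrix.specialOrthogonalGroup (Fin 3) ℝ) (t : ℝ) (T : TotalTranslation n) :
    TotalTranslation n :=
  WithLp.toLp 2 fun p =>
    ((R t p.1 : Matrix (Fin 3) (Fin 3) ℝ) *ᵥ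
      linearVelocity a (fun i => σ i t) (R t) T p.1) p.2

/-- The consensus set: all translations are equal. -/
def consensusSet (n : ℕ) : Set (TotalTranslation n) :=
  {z | ∀ i j, translation z i = translation z j}

end TranslationConsensus

open TranslationConsensus

/-!
Since `R_i R_iᵀ = 1`, the rotations cancel, and each of the three coordinates of the translations
follows the scalar consensus dynamics `ẋ_i = ∑ j, A_ij(t) (x_j - x_i)`. Along it the maximum of the
states does not increase and the minimum does not decrease, which gives stability.

For a nonnegative solution, and row sums of `A` at most `K`, the function `exp (K t) x_i` is
nondecreasing and its derivative is at least `exp (K t) A_ij x_j`. Hence a lower bound on `x_j` is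
passed on to `x_i`, up to a fixed factor, in every time window over which the integral of `A_ij` is
bounded below; by the dwell time, every edge of a union graph is of this kind. Now let the states
lie in `[m, m + d]`, and consider the two sets of agents with `x_i - m ≥ d / 2` and with
`m + d - x_i ≥ d / 2`. Together they contain all agents. In each window the one that contains the
center gains an agent, at the cost of a fixed factor in its lower bound, so after `n` windows one
of the two contains every agent, and the spread of the states has decreased by a fixed factor.
-/

namespace TranslationConsensus

section PiecewiseConstant

theorem forall_mem_Icc_of_real_induction {X : Type*} [ConditionallyCompleteLinearOrder X]
    [TopologicalSpace X] [OrderTopology X] [DenselyOrdered X] {p : X → Prop} {a b : X} (ha : p a)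
    (hleft : ∀ x ∈ Ioc a b, (∀ y ∈ Ico a x, p y) → p x)
    (hright : ∀ x ∈ Ico a b, p x → ∀ᶠ y in 𝓝[>] x, p y) : ∀ x ∈ Icc a b, p x := by
  have hclosed : IsClosed ({x | ∀ y ∈ Icc a x, p y} ∩ Icc a b) := by
    refine isClosed_of_closure_subset fun x hx => ?_
    have hxab : x ∈ Icc a b := closure_minimal inter_subset_right isClosed_Icc hx
    have hlt : ∀ y ∈ Ico a x, p y := fun y hy => by
      obtain ⟨z, hyz, hz, -⟩ := mem_closure_iff.1 hx (Ioi y) isOpen_Ioi hy.2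
      exact hz y ⟨hy.1, le_of_lt hyz⟩
    refine ⟨fun y hy => ?_, hxab⟩
    rcases hy.2.lt_or_eq with hyx | rfl
    · exact hlt y ⟨hy.1, hyx⟩
    rcases hy.1.lt_or_eq with hay | rfl
    · exact hleft y ⟨hay, hxab.2⟩ hlt
    · exact ha
  have hsub := hclosed.Icc_subset_of_forall_mem_nhdsWithin (a := a) (b := b)
    (fun y hy => le_antisymm hy.1 hy.2 ▸ ha) fun x ⟨hx, hxab⟩ => by
      obtain ⟨u, hxu, hu⟩ := (mem_nhdsGT_iff_exists_Ioo_subset' hxab.2).1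
        (hright x hxab (hx x ⟨hxab.1, le_rfl⟩))
      filter_upwards [Ioo_mem_nhdsGT hxu] with y hy z hz
      rcases le_or_gt z x with hzx | hxz
      · exact hx z ⟨hz.1, hzx⟩
      · exact hu ⟨hxz, hz.2.trans_lt hy.2⟩
  exact fun x hx => hsub hx x ⟨hx.1, le_rfl⟩

/-- `s` is right-continuous and piecewise constant: it is constant on a right neighbourhood
`[t, u)` and on a punctured left neighbourhood `(l, t)` of every time `t`, so that it has finitely
many switches on a bounded interval. -/
structure IsPiecewiseConstant {α : Type*} (s : ℝ → α) : Prop where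
  rightContinuous : ∀ t, ∀ᶠ u in 𝓝[≥] t, s u = s t
  eventuallyConst_left : ∀ t, ∃ c, ∀ᶠ u in 𝓝[<] t, s u = c

variable {α β : Type*} {s : ℝ → α}

namespace IsPiecewiseConstant

theorem comp (hs : IsPiecewiseConstant s) (g : α → β) :
    IsPiecewiseConstant fun t => g (s t) where
  rightContinuous t := (hs.rightContinuous t).mono fun _ => congrArg g
  eventuallyConst_left t := by
    obtain ⟨c, hc⟩ := hs.eventuallyConst_left t
    exact ⟨g c, hc.mono fun _ => congrArg g⟩

theorem pi {ι : Type*} [Finite ι] {α : ι → Type*} {s : ∀ i, ℝ → α i}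
    (hs : ∀ i, IsPiecewiseConstant (s i)) : IsPiecewiseConstant fun t i => s i t where
  rightContinuous t := (eventually_all.2 fun i => (hs i).rightContinuous t).mono fun _ => funext
  eventuallyConst_left t := by
    choose c hc using fun i => (hs i).eventuallyConst_left t
    exact ⟨c, (eventually_all.2 hc).mono fun _ => funext⟩

theorem rel_of_rel_of_const (hs : IsPiecewiseConstant s) {r : ℝ → ℝ → Prop}
    (htrans : ∀ a b c, a ≤ b → b ≤ c → r a b → r b c → r a c)
    (hconst : ∀ a b c, a ≤ b → (∀ t ∈ Ico a b, s t = c) → r a b) {a b : ℝ} (hab : a ≤ b) :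
    r a b := by
  refine forall_mem_Icc_of_real_induction (a := a) (b := b)
    (hconst a a (s a) le_rfl (by simp)) (fun x hx hr => ?_) (fun x hx hr => ?_) b ⟨hab, le_rfl⟩
  · obtain ⟨c, hc⟩ := hs.eventuallyConst_left x
    obtain ⟨l, hlx, hl⟩ := mem_nhdsLT_iff_exists_Ioo_subset.1 hc
    obtain ⟨y, hy, hyx⟩ := exists_between (max_lt hx.1 hlx)
    obtain ⟨hay, hly⟩ := max_lt_iff.1 hy
    exact htrans a y x hay.le hyx.le (hr y ⟨hay.le, hyx⟩)
      (hconst y x c hyx.le fun t ht => hl ⟨hly.trans_le ht.1, ht.2⟩)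
  · obtain ⟨u, hxu, hu⟩ := mem_nhdsGE_iff_exists_Ico_subset.1 (hs.rightContinuous x)
    filter_upwards [Ioo_mem_nhdsGT hxu] with y hy
    exact htrans a x y hx.1 hy.1.le hr
      (hconst x y (s x) hy.1.le fun t ht => hu ⟨ht.1, ht.2.trans hy.2⟩)

theorem intervalIntegrable {f : ℝ → ℝ} (hf : IsPiecewiseConstant f) {a b : ℝ} (hab : a ≤ b) :
    IntervalIntegrable f MeasureTheory.volume a b :=
  hf.rel_of_rel_of_const (r := fun a b => IntervalIntegrable f MeasureTheory.volume a b)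
    (fun _ _ _ _ _ => IntervalIntegrable.trans) (fun a b c hab hc => by
      refine (intervalIntegrable_congr_uIoo fun t ht => ?_).2
        (intervalIntegrable_const (c := c))
      rw [uIoo_of_le hab] at ht
      exact hc t (Ioo_subset_Ico_self ht)) hab

end IsPiecewiseConstant

theorem eq_of_forall_not_isSwitchTime (hr : ∀ t, ∀ᶠ u in 𝓝[≥] t, s u = s t) {a b : ℝ}
    (h : ∀ t ∈ Ioc a b, ¬ IsSwitchTime s t) : ∀ t ∈ Icc a b, s t = s a := by
  refine forall_mem_Icc_of_real_induction rfl (fun x hx hs => ?_) fun x _ hs => ?_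
  · have hx_const : ∀ᶠ y in 𝓝[<] x, s y = s x :=
      (not_not.1 (h x hx)).filter_mono nhdsWithin_le_nhds
    obtain ⟨y, hyx, hy⟩ := (hx_const.and (Ioo_mem_nhdsLT hx.1)).exists
    exact hyx.symm.trans (hs y ⟨hy.1.le, hy.2⟩)
  · filter_upwards [(hr x).filter_mono (nhdsWithin_mono x Ioi_subset_Ici_self)] with y hy
    exact hy.trans hs

namespace IsSwitchingSignal

variable {τ : ℝ}

theorem isPiecewiseConstant (hs : IsSwitchingSignal s τ) (hτ : 0 < τ) :
    IsPiecewiseConstant s where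
  rightContinuous := hs.rightContinuous
  eventuallyConst_left t := by
    obtain ⟨l, hlt, hl⟩ : ∃ l < t, ∀ u ∈ Ioo l t, ¬ IsSwitchTime s u := by
      by_contra! hswitch
      obtain ⟨u, hu, hsu⟩ := hswitch (t - τ) (by linarith)
      obtain ⟨w, hw, hsw⟩ := hswitch u hu.2
      linarith [hs.dwell u w hsu hsw hw.1, hu.1, hw.2]
    obtain ⟨m, hlm, hmt⟩ := exists_between hlt
    refine ⟨s m, ?_⟩
    filter_upwards [Ioo_mem_nhdsLT hmt] with u hu
    exact eq_of_forall_not_isSwitchTime hs.rightContinuous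
      (fun v hv => hl v ⟨hlm.trans hv.1, hv.2.trans_lt hu.2⟩) u ⟨hu.1.le, le_rfl⟩

theorem eq_on_right_or_left (hs : IsSwitchingSignal s τ) (t : ℝ) :
    (∀ u ∈ Icc t (t + τ / 2), s u = s t) ∨ ∀ u ∈ Icc (t - τ / 2) t, s u = s t := by
  by_cases hright : ∀ u ∈ Ioc t (t + τ / 2), ¬ IsSwitchTime s u
  · exact .inl (eq_of_forall_not_isSwitchTime hs.rightContinuous hright)
  push Not at hright
  obtain ⟨w, hw, hsw⟩ := hright
  have hleft : ∀ u ∈ Ioc (t - τ / 2) t, ¬ IsSwitchTime s u := fun u hu hsu => by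
    linarith [hs.dwell u w hsu hsw (by linarith [hu.2, hw.1]), hu.1, hw.2]
  have hconst := eq_of_forall_not_isSwitchTime hs.rightContinuous hleft
  exact .inr fun u hu => (hconst u hu).trans (hconst t ⟨hu.1.trans hu.2, le_rfl⟩).symm

end IsSwitchingSignal

end PiecewiseConstant

section LinearSystems

variable {E : Type*} [NormedAddCommGroup E] [NormedSpace ℝ E] {f g : ℝ → E → E} {a b c : ℝ}
  {z w : ℝ → E}

theorem IsSolution.mono (hz : IsSolution f a z) (hab : a ≤ b) : IsSolution f b z :=
  ⟨hz.continuousOn.mono (Ici_subset_Ici.2 hab), fun t ht => hz.hasDerivWithinAt t (hab.trans ht)⟩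

/-- `z` is a solution of `ż = f(t, z)` on the compact interval `[a, b]`, in the sense of right
derivatives on `[a, b)`; compare `IsSolution`. -/
structure IsSolutionOn (f : ℝ → E → E) (a b : ℝ) (z : ℝ → E) : Prop where
  continuousOn : ContinuousOn z (Icc a b)
  hasDerivWithinAt : ∀ t ∈ Ico a b, HasDerivWithinAt z (f t (z t)) (Ici t) t

theorem IsSolution.isSolutionOn (hz : IsSolution f a z) (b : ℝ) : IsSolutionOn f a b z :=
  ⟨hz.continuousOn.mono Icc_subset_Ici_self, fun t ht => hz.hasDerivWithinAt t ht.1⟩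

namespace IsSolutionOn

theorem mono_right (hz : IsSolutionOn f a c z) (hbc : b ≤ c) : IsSolutionOn f a b z :=
  ⟨hz.continuousOn.mono (Icc_subset_Icc_right hbc),
    fun t ht => hz.hasDerivWithinAt t ⟨ht.1, ht.2.trans_le hbc⟩⟩

theorem mono_left (hz : IsSolutionOn f a c z) (hab : a ≤ b) : IsSolutionOn f b c z :=
  ⟨hz.continuousOn.mono (Icc_subset_Icc_left hab),
    fun t ht => hz.hasDerivWithinAt t ⟨hab.trans ht.1, ht.2⟩⟩

theorem congr_field (hz : IsSolutionOn f a b z) (hfg : ∀ t ∈ Ico a b, f t = g t) :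
    IsSolutionOn g a b z :=
  ⟨hz.continuousOn, fun t ht => hfg t ht ▸ hz.hasDerivWithinAt t ht⟩

theorem congr (hz : IsSolutionOn f a b z) (hwz : EqOn w z (Icc a b)) : IsSolutionOn f a b w where
  continuousOn := hz.continuousOn.congr hwz
  hasDerivWithinAt t ht := by
    rw [hwz ⟨ht.1, ht.2.le⟩]
    refine (hz.hasDerivWithinAt t ht).congr_of_eventuallyEq ?_ (hwz ⟨ht.1, ht.2.le⟩)
    filter_upwards [Icc_mem_nhdsGE ht.2] with u hu
    exact hwz ⟨ht.1.trans hu.1, hu.2⟩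

theorem trans (hab : a ≤ b) (hbc : b ≤ c) (h₁ : IsSolutionOn f a b z)
    (h₂ : IsSolutionOn f b c z) : IsSolutionOn f a c z where
  continuousOn := by
    rw [← Icc_union_Icc_eq_Icc hab hbc]
    exact h₁.continuousOn.union_of_isClosed h₂.continuousOn isClosed_Icc isClosed_Icc
  hasDerivWithinAt t ht := (lt_or_ge t b).elim (fun h => h₁.hasDerivWithinAt t ⟨ht.1, h⟩)
    fun h => h₂.hasDerivWithinAt t ⟨h, ht.2⟩

end IsSolutionOn

theorem IsSolution.of_forall_isSolutionOn (hz : ∀ b, a ≤ b → IsSolutionOn f a b z) :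
    IsSolution f a z where
  continuousOn t ht := by
    have hat : a ≤ t := ht
    refine ((hz (t + 1) (by linarith)).continuousOn t ⟨ht, by linarith⟩).mono_of_mem_nhdsWithin ?_
    filter_upwards [self_mem_nhdsWithin, mem_nhdsWithin_of_mem_nhds (Iic_mem_nhds (lt_add_one t))]
      with u hau hut using ⟨hau, hut⟩
  hasDerivWithinAt t ht := (hz (t + 1) (by linarith)).hasDerivWithinAt t ⟨ht, lt_add_one t⟩

/-- Every initial value problem for `ż = f(t, z)` posed at time `a` has a unique solution on the
compact interval `[a, b]`; compare `HasUniqueSolutions`. -/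
def HasUniqueSolutionsOn (f : ℝ → E → E) (a b : ℝ) : Prop :=
  ∀ z₀, ∃ z, IsSolutionOn f a b z ∧ z a = z₀ ∧
    ∀ w, IsSolutionOn f a b w → w a = z₀ → EqOn w z (Icc a b)

theorem HasUniqueSolutionsOn.eqOn (h : HasUniqueSolutionsOn f a b) (hz : IsSolutionOn f a b z)
    (hw : IsSolutionOn f a b w) (hzw : z a = w a) : EqOn z w (Icc a b) := by
  obtain ⟨x, -, -, hx⟩ := h (w a)
  exact (hx z hz hzw).trans (hx w hw rfl).symm

theorem HasUniqueSolutionsOn.congr (h : HasUniqueSolutionsOn g a b)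
    (hfg : ∀ t ∈ Ico a b, f t = g t) : HasUniqueSolutionsOn f a b := fun z₀ => by
  obtain ⟨z, hz, hza, huniq⟩ := h z₀
  exact ⟨z, hz.congr_field fun t ht => (hfg t ht).symm, hza,
    fun w hw => huniq w (hw.congr_field hfg)⟩

theorem HasUniqueSolutionsOn.trans (hab : a ≤ b) (hbc : b ≤ c) (h₁ : HasUniqueSolutionsOn f a b)
    (h₂ : HasUniqueSolutionsOn f b c) : HasUniqueSolutionsOn f a c := by
  intro z₀
  obtain ⟨x, hx, hxa, -⟩ := h₁ z₀
  obtain ⟨y, hy, hyb, -⟩ := h₂ (x b)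
  let z : ℝ → E := fun t => if t ≤ b then x t else y t
  have hzx : EqOn z x (Icc a b) := fun t ht => if_pos ht.2
  have hzy : EqOn z y (Icc b c) := fun t ht => by
    rcases ht.1.eq_or_lt with rfl | hbt
    · exact (if_pos le_rfl).trans hyb.symm
    · exact if_neg hbt.not_ge
  have hza : z a = z₀ := (hzx ⟨le_rfl, hab⟩).trans hxa
  have hz : IsSolutionOn f a c z := (hx.congr hzx).trans hab hbc (hy.congr hzy)
  refine ⟨z, hz, hza, fun w hw hwa => ?_⟩
  have hwz : EqOn w z (Icc a b) :=
    h₁.eqOn (hw.mono_right hbc) (hz.mono_right hbc) (hwa.trans hza.symm)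
  rw [← Icc_union_Icc_eq_Icc hab hbc]
  exact hwz.union (h₂.eqOn (hw.mono_left hab) (hz.mono_left hab) (hwz ⟨hab, le_rfl⟩))

theorem hasUniqueSolutions_of_forall_hasUniqueSolutionsOn
    (h : ∀ a b, a ≤ b → HasUniqueSolutionsOn f a b) : HasUniqueSolutions f := by
  intro t₀ z₀
  choose! x hx hx₀ huniq using fun b (hb : t₀ ≤ b) => h t₀ b hb z₀
  have hdiag : ∀ b, t₀ ≤ b → EqOn (fun t => x t t) (x b) (Icc t₀ b) := fun b hb t ht =>
    (huniq t ht.1 (x b) ((hx b hb).mono_right ht.2) (hx₀ b hb) ⟨ht.1, le_rfl⟩).symm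
  exact ⟨fun t => x t t, .of_forall_isSolutionOn fun b hb => (hx b hb).congr (hdiag b hb),
    hx₀ t₀ le_rfl, fun w hw hw₀ t ht => huniq t ht w (hw.isSolutionOn t) hw₀ ⟨ht, le_rfl⟩⟩

variable [CompleteSpace E]

theorem hasUniqueSolutionsOn_clm (B : E →L[ℝ] E) (a b : ℝ) :
    HasUniqueSolutionsOn (fun _ => B) a b := by
  intro z₀
  let z : ℝ → E := fun t => NormedSpace.exp ((t - a) • B) z₀
  have hza : z a = z₀ := by simp [z]
  have hz' (t : ℝ) : HasDerivAt z (B (z t)) t := by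
    have hexp := (hasDerivAt_exp_smul_const' (𝕂 := ℝ) B (t - a)).comp_sub_const t a
    exact (hexp.clm_apply (hasDerivAt_const t z₀)).congr_deriv (by simp [z])
  have hz : IsSolutionOn (fun _ => B) a b z :=
    ⟨fun t _ => (hz' t).continuousAt.continuousWithinAt, fun t _ => (hz' t).hasDerivWithinAt⟩
  exact ⟨z, hz, hza, fun w hw hwa => ODE_solution_unique (fun _ => B.lipschitz)
    hw.continuousOn hw.hasDerivWithinAt hz.continuousOn hz.hasDerivWithinAt (hwa.trans hza.symm)⟩

theorem IsPiecewiseConstant.hasUniqueSolutions {A : ℝ → E →L[ℝ] E} (hA : IsPiecewiseConstant A) :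
    HasUniqueSolutions fun t z => A t z :=
  hasUniqueSolutions_of_forall_hasUniqueSolutionsOn fun _ _ => hA.rel_of_rel_of_const
    (fun _ _ _ => HasUniqueSolutionsOn.trans)
    fun a b B _ hB => (hasUniqueSolutionsOn_clm B a b).congr fun t ht => by rw [hB t ht]

end LinearSystems

section Consensus

variable {ι : Type*} [Fintype ι] {t₀ : ℝ} {x : ℝ → ι → ℝ}

theorem IsSolution.hasDerivWithinAt_apply {f : ℝ → (ι → ℝ) → ι → ℝ} (hx : IsSolution f t₀ x)
    {t : ℝ} (ht : t₀ ≤ t) (i : ι) :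
    HasDerivWithinAt (fun t => x t i) (f t (x t) i) (Ici t) t :=
  hasDerivWithinAt_pi.1 (hx.hasDerivWithinAt t ht) i

theorem IsSolution.continuousOn_apply {f : ℝ → (ι → ℝ) → ι → ℝ} (hx : IsSolution f t₀ x)
    (i : ι) : ContinuousOn (fun t => x t i) (Ici t₀) :=
  continuousOn_pi.1 hx.continuousOn i

theorem IsSolution.apply_le_of_forall_nonpos_of_isMax {f : ℝ → (ι → ℝ) → ι → ℝ}
    (hf : ∀ t y i, (∀ j, y j ≤ y i) → f t y i ≤ 0) (hx : IsSolution f t₀ x) {m : ℝ}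
    (hm : ∀ i, x t₀ i ≤ m) {t : ℝ} (ht : t₀ ≤ t) (i : ι) : x t i ≤ m := by
  have hne : (Finset.univ : Finset ι).Nonempty := ⟨i, Finset.mem_univ i⟩
  let M : ℝ → ℝ := fun t => Finset.univ.sup' hne (x t)
  have hxM (s : ℝ) (j : ι) : x s j ≤ M s := Finset.le_sup' _ (Finset.mem_univ j)
  have hMcont : ContinuousOn M (Icc t₀ t) := ContinuousOn.finset_sup'_apply hne fun j _ =>
    (hx.continuousOn_apply j).mono Icc_subset_Ici_self
  have hslope : ∀ s ∈ Ico t₀ t, ∀ r, 0 < r → ∃ᶠ u in 𝓝[>] s, slope M s u < r := by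
    intro s hs r hr
    have hcoord (j : ι) : ∀ᶠ u in 𝓝[>] s, x u j < M s + r * (u - s) := by
      rcases (hxM s j).lt_or_eq with hlt | heq
      · have hcont : ContinuousWithinAt (fun u => x u j) (Ioi s) s :=
          (hx.continuousOn_apply j s hs.1).mono (Ioi_subset_Ici hs.1)
        filter_upwards [hcont.eventually_lt_const hlt, self_mem_nhdsWithin] with u hu hsu
        exact hu.trans (lt_add_of_pos_right _ (mul_pos hr (sub_pos.2 hsu)))
      · have hderiv := (hx.hasDerivWithinAt_apply hs.1 j).Ioi_of_Ici
        have hnonpos := hf s (x s) j fun k => (hxM s k).trans heq.ge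
        filter_upwards [hderiv.limsup_slope_le' (lt_irrefl s) (hnonpos.trans_lt hr),
          self_mem_nhdsWithin] with u hu hsu
        rw [slope_def_field, div_lt_iff₀ (sub_pos.2 hsu)] at hu
        linarith
    refine Eventually.frequently ?_
    filter_upwards [eventually_all.2 hcoord, self_mem_nhdsWithin] with u hu hsu
    rw [slope_def_field, div_lt_iff₀ (sub_pos.2 hsu), sub_lt_iff_lt_add']
    exact (Finset.sup'_lt_iff hne).2 fun j _ => hu j
  exact (hxM t i).trans (image_le_of_liminf_slope_right_le_deriv_boundary hMcont
    (Finset.sup'_le hne _ fun j _ => hm j) continuousOn_const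
    (fun s _ => hasDerivWithinAt_const s _ m) hslope ⟨ht, le_rfl⟩)

/-- The right-hand side `∑ j, A i j (x j - x i)` of the scalar consensus dynamics with weights
`A i j`, varying with time. -/
def consensusField (A : ℝ → Matrix ι ι ℝ) (t : ℝ) (x : ι → ℝ) : ι → ℝ :=
  fun i => ∑ j, A t i j * (x j - x i)

variable {A : ℝ → Matrix ι ι ℝ} {K a b : ℝ}

theorem IsSolution.sub_const (hx : IsSolution (consensusField A) t₀ x) (m : ℝ) :
    IsSolution (consensusField A) t₀ fun t i => x t i - m where
  continuousOn := hx.continuousOn.sub continuousOn_const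
  hasDerivWithinAt t ht :=
    ((hx.hasDerivWithinAt t ht).sub_const fun _ => m).congr_deriv <| by
      ext i
      simp only [consensusField, sub_sub_sub_cancel_right]

theorem IsSolution.const_sub (hx : IsSolution (consensusField A) t₀ x) (m : ℝ) :
    IsSolution (consensusField A) t₀ fun t i => m - x t i where
  continuousOn := continuousOn_const.sub hx.continuousOn
  hasDerivWithinAt t ht :=
    ((hx.hasDerivWithinAt t ht).const_sub fun _ => m).congr_deriv <| by
      ext i
      simp only [consensusField, Pi.neg_apply, ← Finset.sum_neg_distrib, ← mul_neg]
      simp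

theorem IsSolution.integral_le_exp_mul_apply_sub (hx : IsSolution (consensusField A) a x)
    (hab : a ≤ b) {φ : ℝ → ℝ} (hφ : IntervalIntegrable φ MeasureTheory.volume a b) {i : ι}
    (hle : ∀ t ∈ Ioo a b,
      φ t ≤ Real.exp (K * (t - a)) * (consensusField A t (x t) i + K * x t i)) :
    ∫ t in a..b, φ t ≤ Real.exp (K * (b - a)) * x b i - x a i := by
  have hexp (t : ℝ) : HasDerivAt (fun t => Real.exp (K * (t - a)))
      (Real.exp (K * (t - a)) * K) t := by
    simpa using (((hasDerivAt_id t).sub_const a).const_mul K).exp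
  have hderiv : ∀ t ∈ Ioo a b, HasDerivWithinAt (fun t => Real.exp (K * (t - a)) * x t i)
      (Real.exp (K * (t - a)) * (consensusField A t (x t) i + K * x t i)) (Ioi t) t :=
    fun t ht => ((hexp t).hasDerivWithinAt.mul
      (hx.hasDerivWithinAt_apply ht.1.le i).Ioi_of_Ici).congr_deriv (by ring)
  have hcont : ContinuousOn (fun t => Real.exp (K * (t - a)) * x t i) (Icc a b) :=
    (by fun_prop : Continuous fun t => Real.exp (K * (t - a))).continuousOn.mul
      ((hx.continuousOn_apply i).mono Icc_subset_Ici_self)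
  simpa using intervalIntegral.integral_le_sub_of_hasDeriv_right_of_le hab hcont hderiv
    ((intervalIntegrable_iff_integrableOn_Icc_of_le hab).1 hφ) hle

section Nonnegative

variable (hA : ∀ t i j, 0 ≤ A t i j)

include hA

theorem IsSolution.apply_le (hx : IsSolution (consensusField A) t₀ x) {m : ℝ}
    (hm : ∀ i, x t₀ i ≤ m) {t : ℝ} (ht : t₀ ≤ t) (i : ι) : x t i ≤ m :=
  hx.apply_le_of_forall_nonpos_of_isMax (fun t _ i hi => Finset.sum_nonpos fun j _ =>
    mul_nonpos_of_nonneg_of_nonpos (hA t i j) (sub_nonpos.2 (hi j))) hm ht i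

theorem IsSolution.le_apply (hx : IsSolution (consensusField A) t₀ x) {m : ℝ}
    (hm : ∀ i, m ≤ x t₀ i) {t : ℝ} (ht : t₀ ≤ t) (i : ι) : m ≤ x t i :=
  sub_nonpos.1 ((hx.const_sub m).apply_le hA (fun j => sub_nonpos.2 (hm j)) ht i)

theorem IsSolution.apply_sub_apply_le (hx : IsSolution (consensusField A) t₀ x) {d : ℝ}
    (hd : ∀ i j, x t₀ i - x t₀ j ≤ d) {t : ℝ} (ht : t₀ ≤ t) (i j : ι) : x t i - x t j ≤ d := by
  have : Nonempty ι := ⟨i⟩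
  obtain ⟨j₀, hj₀⟩ := Finite.exists_min (x t₀)
  have hupper := hx.apply_le hA (m := x t₀ j₀ + d) (fun k => by linarith [hd k j₀]) ht i
  linarith [hx.le_apply hA hj₀ ht j]

variable (hK : ∀ t i, ∑ j, A t i j ≤ K)

include hK

theorem mul_le_consensusField_add (t : ℝ) {y : ι → ℝ} (hy : ∀ i, 0 ≤ y i) (i j : ι) :
    A t i j * y j ≤ consensusField A t y i + K * y i := by
  have hsum : consensusField A t y i = ∑ k, A t i k * y k - (∑ k, A t i k) * y i := by
    simp only [consensusField, mul_sub, Finset.sum_sub_distrib, Finset.sum_mul]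
  have hj : A t i j * y j ≤ ∑ k, A t i k * y k :=
    Finset.single_le_sum (f := fun k => A t i k * y k) (fun k _ => mul_nonneg (hA t i k) (hy k))
      (Finset.mem_univ j)
  linarith [mul_le_mul_of_nonneg_right (hK t i) (hy i)]

theorem IsSolution.apply_le_exp_mul_apply (hx : IsSolution (consensusField A) a x)
    (hx₀ : ∀ i, 0 ≤ x a i) (hab : a ≤ b) (i : ι) : x a i ≤ Real.exp (K * (b - a)) * x b i := by
  refine sub_nonneg.1 ?_
  simpa using hx.integral_le_exp_mul_apply_sub hab (φ := fun _ => 0) (by simp) fun t ht => by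
    have hxt := hx.le_apply hA hx₀ ht.1.le
    exact mul_nonneg (Real.exp_pos _).le ((mul_nonneg (hA t i i) (hxt i)).trans
      (mul_le_consensusField_add hA hK t hxt i i))

theorem IsSolution.integral_mul_apply_le_exp_mul_apply (hx : IsSolution (consensusField A) a x)
    (hx₀ : ∀ i, 0 ≤ x a i) (hab : a ≤ b) {i j : ι}
    (hint : IntervalIntegrable (fun t => A t i j) MeasureTheory.volume a b) :
    (∫ t in a..b, A t i j) * x a j ≤ Real.exp (K * (b - a)) * x b i := by
  rw [← intervalIntegral.integral_mul_const]
  refine (hx.integral_le_exp_mul_apply_sub hab (hint.mul_const (x a j)) fun t ht => ?_).trans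
    (sub_le_self _ (hx₀ i))
  have hxt := hx.le_apply hA hx₀ ht.1.le
  calc A t i j * x a j
      ≤ A t i j * (Real.exp (K * (t - a)) * x t j) :=
        mul_le_mul_of_nonneg_left (hx.apply_le_exp_mul_apply hA hK hx₀ ht.1.le j) (hA t i j)
    _ = Real.exp (K * (t - a)) * (A t i j * x t j) := by ring
    _ ≤ Real.exp (K * (t - a)) * (consensusField A t (x t) i + K * x t i) :=
        mul_le_mul_of_nonneg_left (mul_le_consensusField_add hA hK t hxt i j) (Real.exp_pos _).le

end Nonnegative

section HeavyEdges

theorem exists_notMem_mem_of_reflTransGen {α : Type*} {r : α → α → Prop} {P : Set α}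
    {i c : α} (h : Relation.ReflTransGen r i c) (hi : i ∉ P) (hc : c ∈ P) :
    ∃ i ∉ P, ∃ j ∈ P, r i j := by
  induction h using Relation.ReflTransGen.head_induction_on with
  | refl => exact absurd hc hi
  | @head i j hij _ ih =>
    by_cases hj : j ∈ P
    · exact ⟨i, hi, j, hj, hij⟩
    · exact ih hj

/-- `i` listens to `j` with total weight at least `μ` over the time window `[a, b]`. For `μ > 0`
this forces the weight to be integrable, as the integral of a non-integrable function is `0`. -/
def HeavyEdge (A : ℝ → Matrix ι ι ℝ) (μ a b : ℝ) (i j : ι) : Prop :=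
  μ ≤ ∫ t in a..b, A t i j

/-- The fraction `exp (-(K W)) μ` of a lower bound on nonnegative states that is still guaranteed
after a window of length `W`, both at an agent satisfying it (if `μ ≤ 1`) and at the tail of a
heavy edge to such an agent, when the row sums of the weights are at most `K`. -/
noncomputable def windowFactor (K μ W : ℝ) : ℝ := Real.exp (-(K * W)) * μ

theorem windowFactor_pos {μ : ℝ} (hμ : 0 < μ) (K W : ℝ) : 0 < windowFactor K μ W :=
  mul_pos (Real.exp_pos _) hμ

theorem windowFactor_le_one {μ W : ℝ} (hK : 0 ≤ K) (hμ : 0 ≤ μ) (hμ1 : μ ≤ 1) (hW : 0 ≤ W) :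
    windowFactor K μ W ≤ 1 :=
  mul_le_one₀ (Real.exp_le_one_iff.2 (neg_nonpos.2 (mul_nonneg hK hW))) hμ hμ1

theorem windowFactor_mul_le_iff {μ W y z : ℝ} :
    windowFactor K μ W * y ≤ z ↔ μ * y ≤ Real.exp (K * W) * z := by
  rw [windowFactor, Real.exp_neg, mul_assoc, inv_mul_le_iff₀ (Real.exp_pos _)]

variable {μ β : ℝ} (hA : ∀ t i j, 0 ≤ A t i j) (hK : ∀ t i, ∑ j, A t i j ≤ K)

include hA hK

theorem IsSolution.windowFactor_mul_le_apply (hx : IsSolution (consensusField A) a x)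
    (hx₀ : ∀ i, 0 ≤ x a i) (hab : a ≤ b) (hμ : μ ≤ 1) (i : ι) :
    windowFactor K μ (b - a) * x a i ≤ x b i :=
  windowFactor_mul_le_iff.2 ((mul_le_of_le_one_left (hx₀ i) hμ).trans
    (hx.apply_le_exp_mul_apply hA hK hx₀ hab i))

theorem IsSolution.windowFactor_mul_le_apply_of_heavyEdge
    (hx : IsSolution (consensusField A) a x) (hx₀ : ∀ i, 0 ≤ x a i) (hab : a ≤ b) (hμ : 0 < μ)
    {i j : ι} (hij : HeavyEdge A μ a b i j) : windowFactor K μ (b - a) * x a j ≤ x b i :=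
  have hint := intervalIntegral.intervalIntegrable_of_integral_ne_zero (hμ.trans_le hij).ne'
  windowFactor_mul_le_iff.2 ((mul_le_mul_of_nonneg_right hij (hx₀ j)).trans
    (hx.integral_mul_apply_le_exp_mul_apply hA hK hx₀ hab hint))

theorem IsSolution.exists_larger_forall_windowFactor_mul_le
    (hx : IsSolution (consensusField A) a x) (hx₀ : ∀ i, 0 ≤ x a i) (hab : a ≤ b) (hμ : 0 < μ)
    (hμ1 : μ ≤ 1) {c : ι} (hc : ∀ i, Relation.ReflTransGen (HeavyEdge A μ a b) i c)
    {P : Finset ι} (hcP : c ∈ P) (hP : ∀ i ∈ P, β ≤ x a i) :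
    ∃ Q, P ⊆ Q ∧ (Q = Finset.univ ∨ P.card < Q.card) ∧
      ∀ i ∈ Q, windowFactor K μ (b - a) * β ≤ x b i := by
  have hγ := (windowFactor_pos hμ K (b - a)).le
  have hstay : ∀ i ∈ P, windowFactor K μ (b - a) * β ≤ x b i := fun i hi =>
    (mul_le_mul_of_nonneg_left (hP i hi) hγ).trans
      (hx.windowFactor_mul_le_apply hA hK hx₀ hab hμ1 i)
  by_cases hfull : P = Finset.univ
  · exact ⟨P, Finset.Subset.rfl, .inl hfull, hstay⟩
  obtain ⟨i₀, hi₀⟩ := not_forall.1 (mt Finset.eq_univ_iff_forall.2 hfull)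
  obtain ⟨i, hi, j, hj, hij⟩ := exists_notMem_mem_of_reflTransGen (P := P) (hc i₀) hi₀ hcP
  refine ⟨P.cons i hi, Finset.subset_cons hi, .inr (by simp), fun k hk => ?_⟩
  rcases Finset.mem_cons.1 hk with rfl | hk
  · exact (mul_le_mul_of_nonneg_left (hP j hj) hγ).trans
      (hx.windowFactor_mul_le_apply_of_heavyEdge hA hK hx₀ hab hμ hij)
  · exact hstay k hk

theorem IsSolution.exists_larger_cover {x' : ℝ → ι → ℝ} (hx : IsSolution (consensusField A) a x)
    (hx₀ : ∀ i, 0 ≤ x a i) (hx' : IsSolution (consensusField A) a x') (hx'₀ : ∀ i, 0 ≤ x' a i)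
    (hab : a ≤ b) (hμ : 0 < μ) (hμ1 : μ ≤ 1)
    (hc : ∃ c, ∀ i, Relation.ReflTransGen (HeavyEdge A μ a b) i c) {P Q : Finset ι}
    (hPQ : ∀ i, i ∈ P ∨ i ∈ Q) (hP : ∀ i ∈ P, β ≤ x a i) (hQ : ∀ i ∈ Q, β ≤ x' a i) :
    ∃ P' Q', P ⊆ P' ∧ Q ⊆ Q' ∧
      (P' = Finset.univ ∨ Q' = Finset.univ ∨ P.card + Q.card < P'.card + Q'.card) ∧
      (∀ i ∈ P', windowFactor K μ (b - a) * β ≤ x b i) ∧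
      ∀ i ∈ Q', windowFactor K μ (b - a) * β ≤ x' b i := by
  have hγ := (windowFactor_pos hμ K (b - a)).le
  obtain ⟨c, hc⟩ := hc
  rcases hPQ c with hcP | hcQ
  · obtain ⟨P', hPP', hcard, hP'⟩ :=
      hx.exists_larger_forall_windowFactor_mul_le hA hK hx₀ hab hμ hμ1 hc hcP hP
    exact ⟨P', Q, hPP', Finset.Subset.rfl, hcard.imp_right fun h => .inr (by lia), hP',
      fun i hi => (mul_le_mul_of_nonneg_left (hQ i hi) hγ).trans
        (hx'.windowFactor_mul_le_apply hA hK hx'₀ hab hμ1 i)⟩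
  · obtain ⟨Q', hQQ', hcard, hQ'⟩ :=
      hx'.exists_larger_forall_windowFactor_mul_le hA hK hx'₀ hab hμ hμ1 hc hcQ hQ
    exact ⟨P, Q', Finset.Subset.rfl, hQQ', .inr (hcard.imp_right fun h => by lia),
      fun i hi => (mul_le_mul_of_nonneg_left (hP i hi) hγ).trans
        (hx.windowFactor_mul_le_apply hA hK hx₀ hab hμ1 i), hQ'⟩

variable {W : ℝ} (hμ : 0 < μ) (hμ1 : μ ≤ 1) (hW : 0 ≤ W)
  (hconn : ∀ a, ∃ c, ∀ i, Relation.ReflTransGen (HeavyEdge A μ a (a + W)) i c)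

include hμ hμ1 hW hconn

theorem IsSolution.exists_cover_after_windows {x' : ℝ → ι → ℝ}
    (hx : IsSolution (consensusField A) t₀ x) (hx₀ : ∀ i, 0 ≤ x t₀ i)
    (hx' : IsSolution (consensusField A) t₀ x') (hx'₀ : ∀ i, 0 ≤ x' t₀ i)
    (hβ : ∀ i, β ≤ x t₀ i ∨ β ≤ x' t₀ i) (k : ℕ) :
    ∃ P Q : Finset ι, (∀ i, i ∈ P ∨ i ∈ Q) ∧
      (P = Finset.univ ∨ Q = Finset.univ ∨ Fintype.card ι + k ≤ P.card + Q.card) ∧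
      (∀ i ∈ P, windowFactor K μ W ^ k * β ≤ x (t₀ + k * W) i) ∧
      ∀ i ∈ Q, windowFactor K μ W ^ k * β ≤ x' (t₀ + k * W) i := by
  classical
  induction k with
  | zero =>
    let P := Finset.univ.filter fun i => β ≤ x t₀ i
    let Q := Finset.univ.filter fun i => β ≤ x' t₀ i
    have hPQ (i : ι) : i ∈ P ∨ i ∈ Q := by simpa [P, Q] using hβ i
    have hunion : P ∪ Q = Finset.univ :=
      Finset.eq_univ_of_forall fun i => Finset.mem_union.2 (hPQ i)
    refine ⟨P, Q, hPQ, .inr (.inr ?_), by simp [P], by simp [Q]⟩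
    rw [add_zero, ← Finset.card_univ, ← hunion]
    exact Finset.card_union_le P Q
  | succ k ih =>
    obtain ⟨P, Q, hPQ, hcard, hP, hQ⟩ := ih
    have ht : t₀ ≤ t₀ + k * W := le_add_of_nonneg_right (by positivity)
    obtain ⟨P', Q', hPP', hQQ', hcard', hP', hQ'⟩ := (hx.mono ht).exists_larger_cover hA hK
      (hx.le_apply hA hx₀ ht) (hx'.mono ht) (hx'.le_apply hA hx'₀ ht) (le_add_of_nonneg_right hW)
      hμ hμ1 (hconn _) hPQ hP hQ
    have hend : t₀ + k * W + W = t₀ + (k + 1 : ℕ) * W := by push_cast; ring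
    rw [add_sub_cancel_left, ← mul_assoc, ← pow_succ', hend] at hP' hQ'
    refine ⟨P', Q', fun i => (hPQ i).imp (@hPP' i) (@hQQ' i), ?_, hP', hQ'⟩
    rcases hcard with rfl | rfl | hcard
    · exact .inl (Finset.univ_subset_iff.1 hPP')
    · exact .inr (.inl (Finset.univ_subset_iff.1 hQQ'))
    · exact hcard'.imp_right (Or.imp_right fun h => by lia)

theorem IsSolution.forall_le_or_forall_le_after_windows {x' : ℝ → ι → ℝ}
    (hx : IsSolution (consensusField A) t₀ x) (hx₀ : ∀ i, 0 ≤ x t₀ i)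
    (hx' : IsSolution (consensusField A) t₀ x') (hx'₀ : ∀ i, 0 ≤ x' t₀ i)
    (hβ : ∀ i, β ≤ x t₀ i ∨ β ≤ x' t₀ i) :
    (∀ i, windowFactor K μ W ^ Fintype.card ι * β ≤ x (t₀ + Fintype.card ι * W) i) ∨
      ∀ i, windowFactor K μ W ^ Fintype.card ι * β ≤ x' (t₀ + Fintype.card ι * W) i := by
  obtain ⟨P, Q, -, hcard, hP, hQ⟩ := hx.exists_cover_after_windows hA hK hμ hμ1 hW hconn hx₀ hx'
    hx'₀ hβ (Fintype.card ι)
  have hfull : P = Finset.univ ∨ Q = Finset.univ := by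
    refine hcard.imp_right (Or.rec id fun h => (Finset.card_eq_iff_eq_univ Q).1 ?_)
    exact (Finset.card_le_univ Q).antisymm (by linarith [Finset.card_le_univ P])
  exact hfull.imp (fun h i => hP i (Finset.eq_univ_iff_forall.1 h i))
    fun h i => hQ i (Finset.eq_univ_iff_forall.1 h i)

theorem IsSolution.apply_sub_apply_le_after_windows (hx : IsSolution (consensusField A) t₀ x)
    {d : ℝ} (hd : ∀ i j, x t₀ i - x t₀ j ≤ d) (i j : ι) :
    x (t₀ + Fintype.card ι * W) i - x (t₀ + Fintype.card ι * W) j ≤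
      (1 - windowFactor K μ W ^ Fintype.card ι / 2) * d := by
  have : Nonempty ι := ⟨i⟩
  have ht : t₀ ≤ t₀ + Fintype.card ι * W := le_add_of_nonneg_right (by positivity)
  obtain ⟨j₀, hmin⟩ := Finite.exists_min (x t₀)
  have hmax (k : ι) : x t₀ k ≤ x t₀ j₀ + d := by linarith [hd k j₀]
  rcases (hx.sub_const (x t₀ j₀)).forall_le_or_forall_le_after_windows hA hK hμ hμ1 hW hconn
      (β := d / 2) (fun k => sub_nonneg.2 (hmin k)) (hx.const_sub (x t₀ j₀ + d))
      (fun k => sub_nonneg.2 (hmax k))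
      (fun k => (le_total (x t₀ j₀ + d / 2) (x t₀ k)).imp
        (fun h => by linarith) (fun h => by linarith)) with hlow | hhigh
  · linarith [hlow j, hx.apply_le hA hmax ht i]
  · linarith [hhigh i, hx.le_apply hA hmin ht j]

theorem IsSolution.apply_sub_apply_le_pow_mul (hx : IsSolution (consensusField A) t₀ x)
    {d : ℝ} (hd : ∀ i j, x t₀ i - x t₀ j ≤ d) (k : ℕ) (i j : ι) :
    x (t₀ + k * (Fintype.card ι * W)) i - x (t₀ + k * (Fintype.card ι * W)) j ≤
      (1 - windowFactor K μ W ^ Fintype.card ι / 2) ^ k * d := by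
  induction k generalizing i j with
  | zero => simpa using hd i j
  | succ k ih =>
    have ht : t₀ ≤ t₀ + k * (Fintype.card ι * W) := le_add_of_nonneg_right (by positivity)
    have hend : t₀ + k * (Fintype.card ι * W) + Fintype.card ι * W =
        t₀ + (k + 1 : ℕ) * (Fintype.card ι * W) := by push_cast; ring
    rw [pow_succ', mul_assoc, ← hend]
    exact (hx.mono ht).apply_sub_apply_le_after_windows hA hK hμ hμ1 hW hconn ih i j

theorem IsSolution.tendsto_apply_sub_apply (hx : IsSolution (consensusField A) t₀ x) (i j : ι) :
    Tendsto (fun t => x t i - x t j) atTop (𝓝 0) := by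
  have hK₀ : 0 ≤ K := (Finset.sum_nonneg fun j _ => hA t₀ i j).trans (hK t₀ i)
  have hγ := pow_pos (windowFactor_pos hμ K W) (Fintype.card ι)
  have hγ1 := pow_le_one₀ (n := Fintype.card ι) (windowFactor_pos hμ K W).le
    (windowFactor_le_one hK₀ hμ.le hμ1 hW)
  obtain ⟨d, hd⟩ := (finite_range fun p : ι × ι => x t₀ p.1 - x t₀ p.2).bddAbove
  have hzero : Tendsto (fun k : ℕ => (1 - windowFactor K μ W ^ Fintype.card ι / 2) ^ k * d)
      atTop (𝓝 0) := by
    simpa using (tendsto_pow_atTop_nhds_zero_of_lt_one (by linarith) (by linarith)).mul_const d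
  refine Metric.tendsto_atTop.2 fun ε hε => ?_
  obtain ⟨k, hk⟩ := (hzero.eventually_lt_const hε).exists
  have hspread := hx.apply_sub_apply_le_pow_mul hA hK hμ hμ1 hW hconn
    (fun i j => hd (mem_range_self (i, j))) k
  refine ⟨t₀ + k * (Fintype.card ι * W), fun t ht => ?_⟩
  have hle := (hx.mono (le_add_of_nonneg_right (by positivity))).apply_sub_apply_le hA hspread ht
  rw [dist_zero_right, Real.norm_eq_abs, abs_lt]
  constructor <;> linarith [hle i j, hle j i]

end HeavyEdges

end Consensus

section ClosedLoop

theorem mul_sub_le_integral_of_le_on_Icc {f : ℝ → ℝ} {a b c d α : ℝ} (hac : a ≤ c) (hcd : c ≤ d)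
    (hdb : d ≤ b) (hf₀ : ∀ t, 0 ≤ f t) (hf : IntervalIntegrable f MeasureTheory.volume a b)
    (hα : ∀ t ∈ Icc c d, α ≤ f t) : α * (d - c) ≤ ∫ t in a..b, f t := calc
  α * (d - c) = ∫ _ in c..d, α := by simp [mul_comm]
  _ ≤ ∫ t in c..d, f t := intervalIntegral.integral_mono_on hcd intervalIntegrable_const
      (hf.mono_set (uIcc_subset_uIcc_iff_le.2 (by simp [*, hac.trans, hcd.trans]))) hα
  _ ≤ ∫ t in a..b, f t :=
      intervalIntegral.integral_mono_interval hac hcd hdb (.of_forall hf₀) hf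

theorem kronecker_one_mulVec_apply {S ι ι' κ : Type*} [NonAssocSemiring S] [Fintype ι']
    [Fintype κ] [DecidableEq κ] (A : Matrix ι ι' S) (x : ι' × κ → S) (i : ι) (k : κ) :
    ((A ⊗ₖ (1 : Matrix κ κ S)) *ᵥ x) (i, k) = (A *ᵥ fun j => x (j, k)) i := by
  simp [Matrix.mulVec, dotProduct, Fintype.sum_prod_type, Matrix.one_apply]

variable {n : ℕ}

theorem neg_laplacian_mulVec_apply (A : Matrix (Fin n) (Fin n) ℝ) (y : Fin n → ℝ) (i : Fin n) :
    -(laplacian A *ᵥ y) i = ∑ j, A i j * (y j - y i) := by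
  rw [laplacian, Matrix.sub_mulVec, Pi.sub_apply, Matrix.mulVec_diagonal, neg_sub]
  simp only [Matrix.mulVec, dotProduct, mul_sub, Finset.sum_sub_distrib, Finset.sum_mul]

/-- The adjacency matrices along the switching signals `σ`, as a function of time. -/
abbrev switchedAdjacency (a : Matrix (Fin n) (Fin n) ℝ) (σ : ∀ i : Fin n, ℝ → Neighborhood i)
    (t : ℝ) : Matrix (Fin n) (Fin n) ℝ :=
  adjacency a fun i => σ i t

variable (a : Matrix (Fin n) (Fin n) ℝ) (σ : ∀ i : Fin n, ℝ → Neighborhood i)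
  (R : ℝ → Fin n → Matrix.specialOrthogonalGroup (Fin 3) ℝ)

theorem closedLoop_apply (t : ℝ) (T : TotalTranslation n) (i : Fin n) (k : Fin 3) :
    closedLoop a σ R t T (i, k) =
      consensusField (switchedAdjacency a σ) t (fun i => T (i, k)) i := by
  have hR : (R t i : Matrix (Fin 3) (Fin 3) ℝ) * (R t i : Matrix (Fin 3) (Fin 3) ℝ)ᵀ = 1 :=
    (Matrix.mem_orthogonalGroup_iff (Fin 3) ℝ).1
      (Matrix.mem_specialOrthogonalGroup_iff.1 (R t i).2).1
  simp only [closedLoop, linearVelocity, relTranslation, Matrix.mulVec_sum, Matrix.mulVec_smul,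
    Matrix.mulVec_mulVec, hR, Matrix.one_mulVec, Finset.sum_apply, Pi.smul_apply, Pi.sub_apply,
    smul_eq_mul, translation, consensusField, switchedAdjacency, adjacency, Matrix.of_apply,
    ite_mul, zero_mul, Finset.sum_ite_mem, Finset.univ_inter]

theorem closedLoop_eq (t : ℝ) (T : TotalTranslation n) :
    closedLoop a σ R t T = WithLp.toLp 2
      (-((laplacian (adjacency a fun i => σ i t)) ⊗ₖ (1 : Matrix (Fin 3) (Fin 3) ℝ)) *ᵥ
        WithLp.ofLp T) := by
  ext ⟨i, k⟩
  rw [closedLoop_apply, Matrix.neg_mulVec, PiLp.toLp_apply, Pi.neg_apply,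
    kronecker_one_mulVec_apply, neg_laplacian_mulVec_apply, consensusField]

variable {a σ R} {τ : ℝ}

theorem isPiecewiseConstant_neighborhoods (hτ : 0 < τ) (hσ : ∀ i, IsSwitchingSignal (σ i) τ) :
    IsPiecewiseConstant fun t i => σ i t :=
  .pi fun i => (hσ i).isPiecewiseConstant hτ

theorem hasUniqueSolutions_closedLoop (hτ : 0 < τ) (hσ : ∀ i, IsSwitchingSignal (σ i) τ) :
    HasUniqueSolutions (closedLoop a σ R) := by
  have hlinear := ((isPiecewiseConstant_neighborhoods hτ hσ).comp fun N =>
    Matrix.toEuclideanCLM (𝕜 := ℝ)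
      (-(laplacian (adjacency a N) ⊗ₖ (1 : Matrix (Fin 3) (Fin 3) ℝ)))).hasUniqueSolutions
  rwa [show closedLoop a σ R = _ from funext₂ (closedLoop_eq a σ R)]

theorem IsSolution.coordinate {t₀ : ℝ} {z : ℝ → TotalTranslation n}
    (hz : IsSolution (closedLoop a σ R) t₀ z) (k : Fin 3) :
    IsSolution (consensusField (switchedAdjacency a σ)) t₀ fun t i => z t (i, k) where
  continuousOn := continuousOn_pi.2 fun i =>
    (EuclideanSpace.proj (𝕜 := ℝ) (i, k)).continuous.comp_continuousOn hz.continuousOn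
  hasDerivWithinAt t ht := hasDerivWithinAt_pi.2 fun i => by
    let π : TotalTranslation n →L[ℝ] ℝ := EuclideanSpace.proj (i, k)
    rw [← closedLoop_apply a σ R]
    exact π.hasFDerivAt.comp_hasDerivWithinAt t (hz.hasDerivWithinAt t ht)

theorem infDist_consensusSet_le (z : TotalTranslation n) (c : Fin n) :
    Metric.infDist z (consensusSet n) ≤ ∑ p : Fin n × Fin 3, |z p - z (c, p.2)| := by
  let w : TotalTranslation n := WithLp.toLp 2 fun p => z (c, p.2)
  have hw : w ∈ consensusSet n := fun _ _ => rfl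
  refine (Metric.infDist_le_dist_of_mem hw).trans ?_
  rw [EuclideanSpace.dist_eq, Real.sqrt_le_iff]
  exact ⟨by positivity, Finset.sum_sq_le_sq_sum_of_nonneg fun p _ => abs_nonneg _⟩

theorem apply_sub_apply_le_two_mul_infDist_consensusSet (z : TotalTranslation n) (i j : Fin n)
    (k : Fin 3) : z (i, k) - z (j, k) ≤ 2 * Metric.infDist z (consensusSet n) := by
  have hne : (consensusSet n).Nonempty := ⟨0, fun _ _ => rfl⟩
  have hhalf : (z (i, k) - z (j, k)) / 2 ≤ Metric.infDist z (consensusSet n) := by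
    refine (Metric.le_infDist hne).2 fun w hw => ?_
    have hcoord (l : Fin n) : |z (l, k) - w (l, k)| ≤ dist z w := by
      rw [dist_eq_norm]
      exact PiLp.norm_apply_le (z - w) (l, k)
    have hij : w (i, k) = w (j, k) := congrFun (hw i j) k
    linarith [(abs_le.1 (hcoord i)).2, (abs_le.1 (hcoord j)).1]
  linarith

theorem adjacency_nonneg (ha : ∀ i j, 0 ≤ a i j) (N : ∀ i : Fin n, Neighborhood i)
    (i j : Fin n) : 0 ≤ adjacency a N i j := by
  simp only [adjacency, Matrix.of_apply]
  split_ifs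
  exacts [ha i j, le_rfl]

theorem isStableSet_consensusSet (ha : ∀ i j, 0 ≤ a i j) :
    IsStableSet (closedLoop a σ R) (consensusSet n) := by
  intro t₀ ε hε
  rcases isEmpty_or_nonempty (Fin n) with _ | ⟨⟨c⟩⟩
  · refine ⟨1, one_pos, fun z _ _ t _ => ?_⟩
    rw [Metric.infDist_zero_of_mem (s := consensusSet n) (x := z t) isEmptyElim]
    exact hε.le
  have hn : (0 : ℝ) < n := Nat.cast_pos.2 c.pos
  refine ⟨ε / (6 * n), by positivity, fun z hz hδ t ht => ?_⟩
  have hspread (k : Fin 3) (i j : Fin n) : z t (i, k) - z t (j, k) ≤ ε / (3 * n) := by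
    refine (hz.coordinate k).apply_sub_apply_le (fun t => adjacency_nonneg ha _)
      (fun i j => ?_) ht i j
    calc z t₀ (i, k) - z t₀ (j, k)
        ≤ 2 * Metric.infDist (z t₀) (consensusSet n) :=
          apply_sub_apply_le_two_mul_infDist_consensusSet _ i j k
      _ ≤ 2 * (ε / (6 * n)) := by gcongr
      _ = ε / (3 * n) := by ring
  calc Metric.infDist (z t) (consensusSet n)
      ≤ ∑ p : Fin n × Fin 3, |z t p - z t (c, p.2)| := infDist_consensusSet_le _ c
    _ ≤ ∑ _p : Fin n × Fin 3, ε / (3 * n) := Finset.sum_le_sum fun p _ =>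
        abs_sub_le_iff.2 ⟨hspread p.2 p.1 c, hspread p.2 c p.1⟩
    _ = ε := by
      simp only [Finset.sum_const, Finset.card_univ, Fintype.card_prod, Fintype.card_fin,
        nsmul_eq_mul, Nat.cast_mul, Nat.cast_ofNat]
      field_simp

-- The window exceeds that of the union graph by `τ / 2` on both sides, so that it contains one of
-- the two intervals of length `τ / 2` on which an edge present at time `s` must persist.
theorem heavyEdge_of_adj_unionGraph (ha : ∀ i j, 0 ≤ a i j) (hτ : 0 < τ)
    (hσ : ∀ i, IsSwitchingSignal (σ i) τ) {b S : ℝ} {i j : Fin n}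
    (hij : (unionGraph σ (b + τ / 2) (b + τ / 2 + S)).Adj i j) :
    HeavyEdge (switchedAdjacency a σ) (a i j * (τ / 2)) b (b + (S + τ)) i j := by
  obtain ⟨s, hs, hj⟩ := hij
  have hmem : j ∈ (σ i s).1 := hj
  have hint := ((isPiecewiseConstant_neighborhoods hτ hσ).comp fun N =>
    adjacency a N i j).intervalIntegrable (a := b) (b := b + (S + τ)) (by linarith [hs.1, hs.2])
  have hweight {t : ℝ} (ht : σ i t = σ i s) : a i j ≤ switchedAdjacency a σ t i j := by
    simp only [switchedAdjacency, adjacency, Matrix.of_apply, ht, hmem, if_true, le_refl]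
  have hbound {c : ℝ} (hbc : b ≤ c) (hcb : c + τ / 2 ≤ b + (S + τ))
      (hc : ∀ t ∈ Icc c (c + τ / 2), σ i t = σ i s) :
      a i j * (τ / 2) ≤ ∫ t in b..b + (S + τ), switchedAdjacency a σ t i j := by
    simpa using mul_sub_le_integral_of_le_on_Icc hbc (by linarith) hcb
      (fun t => adjacency_nonneg ha _ i j) hint fun t ht => hweight (hc t ht)
  rcases (hσ i).eq_on_right_or_left s with hright | hleft
  · exact hbound (by linarith [hs.1]) (by linarith [hs.2]) hright
  · exact hbound (c := s - τ / 2) (by linarith [hs.1]) (by linarith [hs.2])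
      (by simpa using hleft)

theorem exists_forall_reflTransGen_heavyEdge (ha : ∀ i j, 0 ≤ a i j) (hτ : 0 < τ)
    (hσ : ∀ i, IsSwitchingSignal (σ i) τ) {S μ : ℝ} (hμ : ∀ i j, μ ≤ a i j * (τ / 2))
    (hconn : ∀ t, IsQuasiStronglyConnected (unionGraph σ t (t + S))) (b : ℝ) :
    ∃ c, ∀ i, Relation.ReflTransGen
      (HeavyEdge (switchedAdjacency a σ) μ b (b + (S + τ))) i c := by
  obtain ⟨c, hc⟩ := hconn (b + τ / 2)
  have hadj (i j : Fin n) (hij : (unionGraph σ (b + τ / 2) (b + τ / 2 + S)).Adj i j) :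
      HeavyEdge (switchedAdjacency a σ) μ b (b + (S + τ)) i j :=
    (hμ i j).trans (heavyEdge_of_adj_unionGraph ha hτ hσ hij)
  exact ⟨c, fun i => Relation.ReflTransGen.mono hadj i c (hc i)⟩

theorem exists_forall_sum_adjacency_le (a : Matrix (Fin n) (Fin n) ℝ) :
    ∃ K, ∀ (N : ∀ i : Fin n, Neighborhood i) (i : Fin n), ∑ j, adjacency a N i j ≤ K := by
  obtain ⟨K, hK⟩ := (finite_range fun p : (∀ i : Fin n, Neighborhood i) × Fin n =>
    ∑ j, adjacency a p.1 p.2 j).bddAbove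
  exact ⟨K, fun N i => hK ⟨(N, i), rfl⟩⟩

theorem isGloballyAttractiveSet_consensusSet (ha : ∀ i j, 0 < a i j) (hτ : 0 < τ)
    (hσ : ∀ i, IsSwitchingSignal (σ i) τ) (hconn : IsUniformlyQuasiStronglyConnected σ) :
    IsGloballyAttractiveSet (closedLoop a σ R) (consensusSet n) := by
  intro t₀ z hz
  obtain ⟨S, hS, hconn⟩ := hconn
  obtain ⟨K, hK⟩ := exists_forall_sum_adjacency_le a
  obtain ⟨μ, ⟨hμ1, hμa⟩, hμ⟩ : ∃ μ : ℝ, (μ ≤ 1 ∧ ∀ i j, μ ≤ a i j * (τ / 2)) ∧ 0 < μ := by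
    have hsmall (c : ℝ) (hc : 0 < c) : ∀ᶠ μ in 𝓝[>] (0 : ℝ), μ ≤ c :=
      (eventually_le_nhds hc).filter_mono nhdsWithin_le_nhds
    exact (((hsmall 1 one_pos).and (eventually_all.2 fun i => eventually_all.2 fun j =>
      hsmall _ (mul_pos (ha i j) (half_pos hτ)))).and self_mem_nhdsWithin).exists
  have ha₀ (i j : Fin n) : 0 ≤ a i j := (ha i j).le
  have hconsensus (k : Fin 3) (i j : Fin n) :
      Tendsto (fun t => z t (i, k) - z t (j, k)) atTop (𝓝 0) :=
    (hz.coordinate k).tendsto_apply_sub_apply (fun t => adjacency_nonneg ha₀ _)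
      (fun t => hK fun i => σ i t) hμ hμ1 (by positivity : 0 ≤ S + τ)
      (exists_forall_reflTransGen_heavyEdge ha₀ hτ hσ hμa hconn) i j
  obtain ⟨c, -⟩ := hconn t₀
  have hsum : Tendsto (fun t => ∑ p : Fin n × Fin 3, |z t p - z t (c, p.2)|) atTop (𝓝 0) := by
    simpa using tendsto_finsetSum Finset.univ fun (p : Fin n × Fin 3) _ =>
      (hconsensus p.2 p.1 c).abs
  exact squeeze_zero (fun _ => Metric.infDist_nonneg)
    (fun t => infDist_consensusSet_le (z t) c) hsum

end ClosedLoop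

end TranslationConsensus

theorem mainTheorem9 (n : ℕ)
    (a : Matrix (Fin n) (Fin n) ℝ) (ha : ∀ i j, 0 < a i j)
    (σ : ∀ i : Fin n, ℝ → Neighborhood i)
    (hσ : ∃ τ > 0, ∀ i, IsSwitchingSignal (σ i) τ)
    (hconn : IsUniformlyQuasiStronglyConnected σ)
    (R : ℝ → Fin n → Matrix.specialOrthogonalGroup (Fin 3) ℝ) :
    (∀ (t : ℝ) (T : TotalTranslation n),
      closedLoop a σ R t T =
        WithLp.toLp 2
          (-((laplacian (adjacency a fun i => σ i t)) ⊗ₖ (1 : Matrix (Fin 3) (Fin 3) ℝ)) *ᵥ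
            WithLp.ofLp T)) ∧
    IsGloballyAsymptoticallyStable (closedLoop a σ R) (consensusSet n) := by
  obtain ⟨τ, hτ, hσ⟩ := hσ
  exact ⟨closedLoop_eq a σ R,
    { hasUniqueSolutions := hasUniqueSolutions_closedLoop hτ hσ
      stable := isStableSet_consensusSet fun i j => (ha i j).le
      attractive := isGloballyAttractiveSet_consensusSet ha hτ hσ hconn }⟩
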